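/- Theorem (Evasiveness Conjecture for bipartite graphs, Yao). Let $V$ and $W$ be finite sets, and let $E = V\times W$ be the set of potential edges of bipartite graphs with colour classes $V$ and $W$. For a set system $\mathcal F\subseteq 2^{E}$, let its argument complexity $c(\mathcal F)$ be the minimal depth of a decision tree that decides, for every unknown set $A\subseteq E$, whether $A\in\mathcal F$, where each inner node of the tree asks a question of the form "Is $e\in A$?" with $e\in E$; in other words, $c(\mathcal F)$ is the number of questions that an optimal strategy needs in the worst case. Call $\mathcal F$ trivial if $c(\mathcal F)=0$ (that is, if $\mathcal F=\emptyset$ or $\mathcal F=2^E$), and evasive if $c(\mathcal F)=|E|=|V|\cdot|W|$. A bipartite graph property on $V\times W$ is a set system $\mathcal F\subseteq 2^{V\times W}$ that is invariant under all permutations of $V$ and all permutations of $W$; it is monotone if it is preserved under deletion of edges, that is, if $B\subseteq A\in\mathcal F$ implies $B\in\mathcal F$. Then every monotone non-trivial bipartite graph property on $V\times W$ is evasive. -/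

import Mathlib

namespace Evasiveness

/-- A decision tree with questions of the form "is `e ∈ A`?" for `e : E`. A leaf carries the answer
YES (`true`) or NO (`false`); `node e no yes` asks about `e` and continues with `yes` if `e ∈ A` and
with `no` if `e ∉ A`. -/
inductive DecisionTree (E : Type*) where
  | leaf (answer : Bool) : DecisionTree E
  | node (e : E) (no yes : DecisionTree E) : DecisionTree E

namespace DecisionTree

variable {E : Type*}

open Classical in
/-- The label of the leaf that the input set `A` reaches. -/
noncomputable def run (A : Set E) : DecisionTree E → Bool
  | leaf answer => answer
  | node e no yes => if e ∈ A then run A yes else run A no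

/-- The depth of the tree, that is, the number of questions asked in the worst case. -/
def depth : DecisionTree E → ℕ
  | leaf _ => 0
  | node _ no yes => max (depth no) (depth yes) + 1

/-- `T` is a decision tree for the set system `F`: on every input `A` it reaches a leaf that
correctly answers the question "is `A ∈ F`?". -/
def Decides (T : DecisionTree E) (F : Set (Set E)) : Prop :=
  ∀ A : Set E, T.run A = true ↔ A ∈ F

end DecisionTree

/-- The argument complexity of the set system `F`: the number of questions that an optimal decision
tree for `F` asks in the worst case. (For finite `E` the infimum is attained,
by `exists_decides`.) -/
noncomputable def argumentComplexity {E : Type*} (F : Set (Set E)) : ℕ :=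
  sInf {d : ℕ | ∃ T : DecisionTree E, T.Decides F ∧ T.depth = d}

/-- A set system is trivial if no questions need to be asked. -/
def IsTrivial {E : Type*} (F : Set (Set E)) : Prop :=
  argumentComplexity F = 0

/-- A set system on a finite ground set `E` is evasive if every strategy has to ask about all
elements of `E` in the worst case. -/
def IsEvasive {E : Type*} (F : Set (Set E)) : Prop :=
  argumentComplexity F = Nat.card E

/-- A property of bipartite graphs with colour classes `V` and `W`. A graph is given by its edge set
`A ⊆ V × W`, and a property by the family `F` of its members; it has to be preserved under
renumbering the vertices in `V` and the vertices in `W`. -/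
def IsBipartiteGraphProperty {V W : Type*} (F : Set (Set (V × W))) : Prop :=
  ∀ (σ : Equiv.Perm V) (τ : Equiv.Perm W) (A : Set (V × W)),
    A ∈ F → Prod.map σ τ '' A ∈ F

/-- A set system is monotone if it is closed under taking subsets; for graph properties this means
that they are preserved under deletion of edges. -/
def IsMonotone {E : Type*} (F : Set (Set E)) : Prop :=
  ∀ A B : Set E, A ∈ F → B ⊆ A → B ∈ F

/-- A set system on a finite ground set has a decision tree, of depth at most the number of elements
of the ground set. -/
theorem exists_decides {E : Type*} [Finite E] (F : Set (Set E)) :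
    ∃ T : DecisionTree E, T.Decides F ∧ T.depth ≤ Nat.card E := by
  classical
  have key : ∀ (s : Finset E) (F : Set (Set E)),
      (∀ A B : Set E, (∀ x ∈ s, x ∈ A ↔ x ∈ B) → A ∈ F → B ∈ F) →
      ∃ T : DecisionTree E, T.Decides F ∧ T.depth ≤ s.card := by
    intro s
    induction s using Finset.induction_on with
    | empty =>
      intro F hF
      refine ⟨.leaf (decide (∅ ∈ F)), fun A => ?_, by simp [DecisionTree.depth]⟩
      simp only [DecisionTree.run, decide_eq_true_eq]
      exact ⟨hF _ _ (by simp), hF _ _ (by simp)⟩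
    | insert e s he ih =>
      intro F hF
      obtain ⟨T₀, h₀, d₀⟩ := ih {A | A \ {e} ∈ F} (by
        intro A B hAB hA
        refine hF _ _ (fun x hx => ?_) hA
        rcases Finset.mem_insert.1 hx with rfl | hx
        · simp
        · simp [hAB x hx])
      obtain ⟨T₁, h₁, d₁⟩ := ih {A | insert e A ∈ F} (by
        intro A B hAB hA
        refine hF _ _ (fun x hx => ?_) hA
        rcases Finset.mem_insert.1 hx with rfl | hx
        · simp
        · simp [hAB x hx])
      refine ⟨.node e T₀ T₁, fun A => ?_, ?_⟩
      · by_cases hA : e ∈ A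
        · simp [DecisionTree.run, hA, h₁ A]
        · simp [DecisionTree.run, hA, h₀ A]
      · rw [Finset.card_insert_of_notMem he]
        simp only [DecisionTree.depth]
        omega
  have := Fintype.ofFinite E
  obtain ⟨T, hT, hd⟩ := key Finset.univ F (fun A B h hA => by
    have : A = B := Set.ext fun x => h x (Finset.mem_univ x)
    exact this ▸ hA)
  exact ⟨T, hT, by simpa [Nat.card_eq_fintype_card] using hd⟩

end Evasiveness

/-! Suppose `F` is not evasive. Its members form a simplicial complex on `V × W`, and a decision
tree that never needs all questions dismantles it through links and deletions, so its reduced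
rational homology vanishes (`isAcyclic_of_depth_lt`).

Let a cyclic rotation of `W` act on this complex. By acyclicity the Hopf trace formula
(`sum_inversionSign_eq_zero`) makes the signed count of invariant faces, including the empty one,
zero. The invariant faces are the products `S × W`, and the orientation signs combine with the
parities to leave `(-1) ^ |S|`.

By symmetry in `V` and monotonicity, `S × W ∈ F` depends only on `|S|` and holds up to some size. A
proper truncation of the alternating binomial sum is, up to sign, a nonzero binomial coefficient, so
vanishing forces `V × W ∈ F`, and `F` is trivial (`of_alternating_sum_eq_zero`). -/

namespace Evasiveness

/-! ### Exterior algebra on the ground set and the simplicial boundary. -/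

section Chains

/-- The operator that multiplies a set by the parity of its size. -/
noncomputable def parity {E : Type*} : (Finset E →₀ ℚ) →ₗ[ℚ] (Finset E →₀ ℚ) :=
  Finsupp.linearCombination ℚ fun A => Finsupp.single A ((-1) ^ A.card)

theorem parity_single {E : Type*} (A : Finset E) (q : ℚ) :
    parity (Finsupp.single A q) = Finsupp.single A (q * (-1) ^ A.card) := by
  simp [parity]

variable {E : Type*} [LinearOrder E]

/-- The sign of removing (or inserting) `x` from `A`: `-1` to the number of smaller elements. -/
def incidenceSign (x : E) (A : Finset E) : ℚ := ∏ y ∈ A, if y < x then -1 else 1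

theorem incidenceSign_mul_self (x : E) (A : Finset E) :
    incidenceSign x A * incidenceSign x A = 1 := by
  rw [incidenceSign, ← Finset.prod_mul_distrib]
  exact Finset.prod_eq_one fun y _ => by split_ifs <;> norm_num

theorem incidenceSign_insert {x y : E} {A : Finset E} (hy : y ∉ A) :
    incidenceSign x (insert y A) = (if y < x then -1 else 1) * incidenceSign x A :=
  Finset.prod_insert hy

theorem incidenceSign_insert_self {x : E} {A : Finset E} (hx : x ∉ A) :
    incidenceSign x (insert x A) = incidenceSign x A := by
  simp [incidenceSign_insert hx]

/-- Contraction with the coordinate `x` on the chains spanned by the finite subsets of `E`. -/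
noncomputable def annihilation (x : E) : (Finset E →₀ ℚ) →ₗ[ℚ] (Finset E →₀ ℚ) :=
  Finsupp.linearCombination ℚ fun A =>
    if x ∈ A then Finsupp.single (A.erase x) (incidenceSign x A) else 0

/-- Exterior multiplication by `x` on the chains spanned by the finite subsets of `E`. -/
noncomputable def creation (x : E) : (Finset E →₀ ℚ) →ₗ[ℚ] (Finset E →₀ ℚ) :=
  Finsupp.linearCombination ℚ fun A =>
    if x ∈ A then 0 else Finsupp.single (insert x A) (incidenceSign x A)

theorem annihilation_single (x : E) (A : Finset E) (q : ℚ) :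
    annihilation x (Finsupp.single A q) =
      if x ∈ A then Finsupp.single (A.erase x) (q * incidenceSign x A) else 0 := by
  simp [annihilation]

theorem annihilation_single_insert {x : E} {A : Finset E} (hx : x ∉ A) (q : ℚ) :
    annihilation x (Finsupp.single (insert x A) q) =
      Finsupp.single A (q * incidenceSign x A) := by
  simp [annihilation_single, hx, incidenceSign_insert_self]

theorem annihilation_single_of_notMem {x : E} {A : Finset E} (hx : x ∉ A) (q : ℚ) :
    annihilation x (Finsupp.single A q) = 0 := by
  simp [annihilation_single, hx]

theorem creation_single (x : E) (A : Finset E) (q : ℚ) :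
    creation x (Finsupp.single A q) =
      if x ∈ A then 0 else Finsupp.single (insert x A) (q * incidenceSign x A) := by
  simp [creation]

theorem creation_single_of_notMem {x : E} {A : Finset E} (hx : x ∉ A) (q : ℚ) :
    creation x (Finsupp.single A q) = Finsupp.single (insert x A) (q * incidenceSign x A) := by
  simp [creation_single, hx]

theorem creation_single_of_mem {x : E} {A : Finset E} (hx : x ∈ A) (q : ℚ) :
    creation x (Finsupp.single A q) = 0 := by
  simp [creation_single, hx]

theorem annihilation_creation_self_add (x : E) (z : Finset E →₀ ℚ) :
    annihilation x (creation x z) + creation x (annihilation x z) = z := by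
  induction z using Finsupp.induction_linear with
  | zero => simp
  | add f g hf hg =>
    rw [map_add, map_add, map_add, map_add, add_add_add_comm, hf, hg]
  | single A q =>
    by_cases hx : x ∈ A
    · obtain ⟨B, hB, rfl⟩ : ∃ B, x ∉ B ∧ A = insert x B :=
        ⟨A.erase x, by simp, (Finset.insert_erase hx).symm⟩
      rw [creation_single_of_mem hx, annihilation_single_insert hB, creation_single_of_notMem hB,
        mul_assoc, incidenceSign_mul_self]
      simp
    · rw [creation_single_of_notMem hx, annihilation_single_insert hx,
        annihilation_single_of_notMem hx, mul_assoc, incidenceSign_mul_self]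
      simp

theorem annihilation_creation_of_ne {x y : E} (hxy : x ≠ y) (z : Finset E →₀ ℚ) :
    annihilation y (creation x z) = -creation x (annihilation y z) := by
  induction z using Finsupp.induction_linear with
  | zero => simp
  | add f g hf hg => simp only [map_add, hf, hg, neg_add]
  | single A q =>
    by_cases hx : x ∈ A
    · rw [creation_single_of_mem hx, annihilation_single]
      split_ifs with hy
      · rw [creation_single_of_mem (by simp [hx, hxy])]; simp
      · simp
    · rw [creation_single_of_notMem hx]
      by_cases hy : y ∈ A
      · obtain ⟨B, hB, rfl⟩ : ∃ B, y ∉ B ∧ A = insert y B :=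
          ⟨A.erase y, by simp, (Finset.insert_erase hy).symm⟩
        have hxB : x ∉ B := fun h => hx (Finset.mem_insert_of_mem h)
        rw [annihilation_single_insert hB, creation_single_of_notMem hxB, Finset.insert_comm,
          annihilation_single_insert (by simp [hB, hxy.symm]), ← Finsupp.single_neg,
          incidenceSign_insert hB, incidenceSign_insert hxB]
        congr 1
        rcases lt_or_gt_of_ne hxy with h | h <;> simp [h, h.not_gt] <;> ring
      · rw [annihilation_single_of_notMem (by simp [hy, hxy.symm]),
          annihilation_single_of_notMem hy]
        simp

theorem annihilation_annihilation (x y : E) (z : Finset E →₀ ℚ) :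
    annihilation x (annihilation y z) = -annihilation y (annihilation x z) := by
  induction z using Finsupp.induction_linear with
  | zero => simp
  | add f g hf hg => simp only [map_add, hf, hg, neg_add]
  | single A q =>
    by_cases hxy : x = y
    · subst hxy
      by_cases hx : x ∈ A
      · rw [annihilation_single, if_pos hx, annihilation_single_of_notMem (by simp), neg_zero]
      · rw [annihilation_single_of_notMem hx, map_zero, neg_zero]
    by_cases hx : x ∈ A
    · by_cases hy : y ∈ A
      · obtain ⟨B, hxB, hyB, rfl⟩ : ∃ B, x ∉ B ∧ y ∉ B ∧ A = insert x (insert y B) := by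
          refine ⟨(A.erase x).erase y, by simp, by simp, ?_⟩
          rw [Finset.insert_erase (by simp [hy, Ne.symm hxy]), Finset.insert_erase hx]
        rw [annihilation_single_insert (by simp [hxy, hxB]), annihilation_single_insert hyB,
          Finset.insert_comm, annihilation_single_insert (by simp [Ne.symm hxy, hyB]),
          annihilation_single_insert hxB, incidenceSign_insert hxB, incidenceSign_insert hyB,
          ← Finsupp.single_neg]
        congr 1
        rcases lt_or_gt_of_ne hxy with h | h <;> simp [h, h.not_gt] <;> ring
      · rw [annihilation_single_of_notMem hy, annihilation_single, if_pos hx,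
          annihilation_single_of_notMem (by simp [hy])]
        simp
    · rw [annihilation_single_of_notMem hx, annihilation_single]
      split_ifs
      · rw [annihilation_single_of_notMem (by simp [hx])]; simp
      · simp

/-- The sign of the restriction of `σ` to `A`, as the parity of its number of inversions. -/
def inversionSign (σ : Equiv.Perm E) (A : Finset E) : ℚ :=
  ∏ x ∈ A, ∏ y ∈ A, if y < x ∧ σ x < σ y then -1 else 1

/-- The pair `x, y` is inverted exactly when one but not both of `y < x` and `σ y < σ x` holds, so
the new inversions contribute the product of the two incidence signs. This makes `permAction` a
chain map. -/
theorem inversionSign_insert_mul (σ : Equiv.Perm E) {x : E} {A : Finset E} (hx : x ∉ A) :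
    inversionSign σ (insert x A) * incidenceSign (σ x) (A.map σ.toEmbedding) =
      incidenceSign x A * inversionSign σ A := by
  have key : inversionSign σ (insert x A) =
      incidenceSign x A * incidenceSign (σ x) (A.map σ.toEmbedding) * inversionSign σ A := by
    simp only [inversionSign, Finset.prod_insert hx, Finset.prod_mul_distrib, incidenceSign,
      Finset.prod_map, lt_irrefl, false_and, if_false, one_mul]
    rw [← mul_assoc]
    congr 1
    rw [← Finset.prod_mul_distrib, ← Finset.prod_mul_distrib]
    refine Finset.prod_congr rfl fun y hy => ?_
    have hne : x ≠ y := fun h => hx (h ▸ hy)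
    have hne' : σ x ≠ σ y := σ.injective.ne hne
    rcases lt_or_gt_of_ne hne with h | h <;> rcases lt_or_gt_of_ne hne' with h' | h' <;>
      simp [h, h', h.not_gt, h'.not_gt]
  rw [key]
  linear_combination incidenceSign x A * inversionSign σ A *
    incidenceSign_mul_self (σ x) (A.map σ.toEmbedding)

/-- The action of a permutation of the ground set on chains. -/
noncomputable def permAction (σ : Equiv.Perm E) : (Finset E →₀ ℚ) →ₗ[ℚ] (Finset E →₀ ℚ) :=
  Finsupp.linearCombination ℚ fun A =>
    Finsupp.single (A.map σ.toEmbedding) (inversionSign σ A)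

theorem permAction_single (σ : Equiv.Perm E) (A : Finset E) (q : ℚ) :
    permAction σ (Finsupp.single A q) =
      Finsupp.single (A.map σ.toEmbedding) (q * inversionSign σ A) := by
  simp [permAction]

theorem annihilation_permAction (σ : Equiv.Perm E) (x : E) (z : Finset E →₀ ℚ) :
    annihilation (σ x) (permAction σ z) = permAction σ (annihilation x z) := by
  induction z using Finsupp.induction_linear with
  | zero => simp
  | add f g hf hg => simp only [map_add, hf, hg]
  | single A q =>
    by_cases hx : x ∈ A
    · obtain ⟨B, hB, rfl⟩ : ∃ B, x ∉ B ∧ A = insert x B :=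
        ⟨A.erase x, by simp, (Finset.insert_erase hx).symm⟩
      rw [annihilation_single_insert hB, permAction_single, permAction_single, Finset.map_insert]
      change annihilation (σ x) (Finsupp.single (insert (σ x) _) _) = _
      rw [annihilation_single_insert (by simpa using hB), mul_assoc, mul_assoc,
        inversionSign_insert_mul σ hB]
    · rw [permAction_single, annihilation_single_of_notMem (by simpa using hx),
        annihilation_single_of_notMem hx, map_zero]

theorem annihilation_parity (x : E) (z : Finset E →₀ ℚ) :
    annihilation x (parity z) = -parity (annihilation x z) := by
  induction z using Finsupp.induction_linear with
  | zero => simp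
  | add f g hf hg => simp only [map_add, hf, hg, neg_add]
  | single A q =>
    by_cases hx : x ∈ A
    · obtain ⟨B, hB, rfl⟩ : ∃ B, x ∉ B ∧ A = insert x B :=
        ⟨A.erase x, by simp, (Finset.insert_erase hx).symm⟩
      rw [parity_single, annihilation_single_insert hB, annihilation_single_insert hB,
        parity_single, ← Finsupp.single_neg, Finset.card_insert_of_notMem hB]
      congr 1
      ring
    · rw [parity_single, annihilation_single_of_notMem hx, annihilation_single_of_notMem hx]
      simp

variable [Fintype E]

/-- The boundary operator of the augmented chain complex of the full simplex on `E`. -/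
noncomputable def boundary : (Finset E →₀ ℚ) →ₗ[ℚ] (Finset E →₀ ℚ) := ∑ x, annihilation x

theorem boundary_apply (z : Finset E →₀ ℚ) : boundary z = ∑ x, annihilation x z := by
  simp [boundary]

theorem boundary_annihilation (x : E) (z : Finset E →₀ ℚ) :
    boundary (annihilation x z) = -annihilation x (boundary z) := by
  simp only [boundary_apply, map_sum, ← Finset.sum_neg_distrib]
  exact Finset.sum_congr rfl fun y _ => annihilation_annihilation y x z

theorem boundary_boundary (z : Finset E →₀ ℚ) : boundary (boundary z) = 0 := by
  have h : boundary (boundary z) = -boundary (boundary z) := by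
    conv_lhs => rw [boundary_apply z, map_sum]
    conv_rhs => rw [boundary_apply (boundary z)]
    simp only [boundary_annihilation, Finset.sum_neg_distrib]
  exact self_eq_neg.1 h

/-- Coning with apex `x` is a contracting homotopy: for `y ≠ x` the terms cancel by anticommutation,
and only `annihilation x` survives. -/
theorem boundary_creation_add (x : E) (z : Finset E →₀ ℚ) :
    boundary (creation x z) + creation x (boundary z) = z := by
  rw [boundary_apply, boundary_apply, map_sum, ← Finset.sum_add_distrib,
    Finset.sum_eq_single x (fun y _ hy => by
      rw [annihilation_creation_of_ne hy.symm, neg_add_cancel]) (by simp)]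
  exact annihilation_creation_self_add x z

theorem boundary_permAction (σ : Equiv.Perm E) (z : Finset E →₀ ℚ) :
    boundary (permAction σ z) = permAction σ (boundary z) := by
  rw [boundary_apply, boundary_apply, map_sum, ← Equiv.sum_comp σ]
  exact Finset.sum_congr rfl fun x _ => annihilation_permAction σ x z

theorem boundary_parity (z : Finset E →₀ ℚ) : boundary (parity z) = -parity (boundary z) := by
  rw [boundary_apply, boundary_apply, map_sum, ← Finset.sum_neg_distrib]
  exact Finset.sum_congr rfl fun x _ => annihilation_parity x z

end Chains

/-! ### Traces on exact complexes. -/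

/-- Exactness over a field yields a homotopy `h` with `d h + h d = 1`; cyclicity of the trace and `d
T = -T d` then cancel the two halves of `tr (T (d h + h d))`. No grading is needed: composing a
chain map with `parity` turns its alternating trace into an ordinary one. -/
theorem trace_eq_zero_of_anticommute {K M : Type*} [Field K] [AddCommGroup M] [Module K M]
    [FiniteDimensional K M] {d T : Module.End K M} (hd : ∀ z, d (d z) = 0)
    (hexact : ∀ z, d z = 0 → ∃ c, d c = z) (hT : ∀ z, d (T z) = -T (d z)) :
    LinearMap.trace K M T = 0 := by
  obtain ⟨s, hs⟩ := d.rangeRestrict.exists_rightInverse_of_surjective d.range_rangeRestrict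
  have hs' : ∀ y : LinearMap.range d, d (s y) = y := fun y =>
    congrArg Subtype.val (LinearMap.congr_fun hs y)
  have hker : ∀ z, z - s (d.rangeRestrict z) ∈ LinearMap.range d := fun z =>
    hexact _ (by rw [map_sub, hs', sub_eq_zero]; rfl)
  -- `z - s (d z)` is a cycle, hence a boundary, so `s` can be applied to it again.
  let p : M →ₗ[K] LinearMap.range d :=
    (LinearMap.id - s ∘ₗ d.rangeRestrict).codRestrict _ hker
  let h : Module.End K M := s ∘ₗ p
  have hdh : d * h + h * d = 1 := by
    ext z
    have h1 : d (h z) = z - s (d.rangeRestrict z) := hs' (p z)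
    have h2 : p (d z) = d.rangeRestrict z := by
      apply Subtype.ext
      change d z - s (d.rangeRestrict (d z)) = d z
      have : d.rangeRestrict (d z) = 0 := Subtype.ext (hd z)
      rw [this, map_zero, sub_zero]
    have h3 : h (d z) = s (d.rangeRestrict z) := congrArg s h2
    change d (h z) + h (d z) = z
    rw [h1, h3, sub_add_cancel]
  have hdT : d * T = -(T * d) := LinearMap.ext hT
  calc LinearMap.trace K M T = LinearMap.trace K M (T * (d * h + h * d)) := by
        rw [hdh, mul_one]
    _ = LinearMap.trace K M (T * d * h) + LinearMap.trace K M (d * (T * h)) := by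
        rw [mul_add, map_add, LinearMap.trace_mul_comm K d, mul_assoc, mul_assoc]
    _ = 0 := by rw [← mul_assoc d, hdT, neg_mul, map_neg, add_neg_cancel]

theorem map_mem_supported {α : Type*} {R : Type*} [Semiring R] {G H : Set α}
    {L : (α →₀ R) →ₗ[R] (α →₀ R)}
    (hL : ∀ A ∈ G, ∀ q, L (Finsupp.single A q) ∈ Finsupp.supported R R H)
    {z : α →₀ R} (hz : z ∈ Finsupp.supported R R G) : L z ∈ Finsupp.supported R R H := by
  rw [← Finsupp.sum_single z, Finsupp.sum, map_sum]
  exact Submodule.sum_mem _ fun A hA => hL A (hz hA) _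

/-! ### Acyclic complexes, decision trees and the Hopf trace formula. -/

section Acyclic

variable {E : Type*} [LinearOrder E]

theorem annihilation_mem_supported {G H : Set (Finset E)} {x : E}
    (h : ∀ A ∈ G, x ∈ A → A.erase x ∈ H) {z : Finset E →₀ ℚ}
    (hz : z ∈ Finsupp.supported ℚ ℚ G) : annihilation x z ∈ Finsupp.supported ℚ ℚ H := by
  refine map_mem_supported (fun A hA q => ?_) hz
  rw [annihilation_single]
  split_ifs with hx
  · exact Finsupp.single_mem_supported _ _ (h A hA hx)
  · exact Submodule.zero_mem _

theorem creation_mem_supported {G H : Set (Finset E)} {x : E}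
    (h : ∀ A ∈ G, x ∉ A → insert x A ∈ H) {z : Finset E →₀ ℚ}
    (hz : z ∈ Finsupp.supported ℚ ℚ G) : creation x z ∈ Finsupp.supported ℚ ℚ H := by
  refine map_mem_supported (fun A hA q => ?_) hz
  rw [creation_single]
  split_ifs with hx
  · exact Submodule.zero_mem _
  · exact Finsupp.single_mem_supported _ _ (h A hA hx)

variable [Fintype E]

/-- The reduced rational homology of the simplicial complex `G` vanishes. -/
def IsAcyclic (G : Set (Finset E)) : Prop :=
  ∀ z ∈ Finsupp.supported ℚ ℚ G, boundary z = 0 →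
    ∃ c ∈ Finsupp.supported ℚ ℚ G, boundary c = z

theorem boundary_mem_supported {G : Set (Finset E)} (hG : IsLowerSet G) {z : Finset E →₀ ℚ}
    (hz : z ∈ Finsupp.supported ℚ ℚ G) : boundary z ∈ Finsupp.supported ℚ ℚ G := by
  rw [boundary_apply]
  exact Submodule.sum_mem _ fun x _ =>
    annihilation_mem_supported (fun A hA _ => hG (Finset.erase_subset x A) hA) hz

theorem isAcyclic_empty : IsAcyclic (∅ : Set (Finset E)) := by
  intro z hz _
  rw [Finsupp.supported_empty, Submodule.mem_bot] at hz
  exact ⟨0, Submodule.zero_mem _, by rw [hz, map_zero]⟩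

theorem isAcyclic_of_cone {G : Set (Finset E)} (x : E) (h : ∀ A ∈ G, insert x A ∈ G) :
    IsAcyclic G := fun z hz hz0 =>
  ⟨creation x z, creation_mem_supported (fun A hA _ => h A hA) hz, by
    have := boundary_creation_add x z
    rwa [hz0, map_zero, add_zero] at this⟩

/-- A Mayer–Vietoris argument on chains. The part of a cycle `z` through `x` is a cone over a cycle
of the link, which bounds some `c`. Adding the boundary of the cone over `c` moves `z` into the
deletion, where it bounds. -/
theorem isAcyclic_of_deletion_of_link {G : Set (Finset E)} (hG : IsLowerSet G) (x : E)
    (hdel : IsAcyclic {A ∈ G | x ∉ A}) (hlink : IsAcyclic {A | x ∉ A ∧ insert x A ∈ G}) :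
    IsAcyclic G := by
  intro z hz hz0
  have hb : annihilation x z ∈ Finsupp.supported ℚ ℚ {A | x ∉ A ∧ insert x A ∈ G} :=
    annihilation_mem_supported (fun A hA hx => by simpa [Finset.insert_erase hx] using hA) hz
  obtain ⟨c, hc, hcb⟩ := hlink _ hb (by rw [boundary_annihilation, hz0, map_zero, neg_zero])
  have hwc : creation x c ∈ Finsupp.supported ℚ ℚ G :=
    creation_mem_supported (fun A hA _ => hA.2) hc
  have ha : annihilation x (creation x z) ∈ Finsupp.supported ℚ ℚ {A ∈ G | x ∉ A} := by
    refine map_mem_supported (L := annihilation x ∘ₗ creation x) (fun A hA q => ?_) hz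
    rw [LinearMap.comp_apply, creation_single]
    split_ifs with hx
    · rw [map_zero]; exact Submodule.zero_mem _
    · rw [annihilation_single_insert hx]
      exact Finsupp.single_mem_supported ℚ _ (show A ∈ {A ∈ G | x ∉ A} from ⟨hA, hx⟩)
  have hc' : c ∈ Finsupp.supported ℚ ℚ {A ∈ G | x ∉ A} :=
    Finsupp.supported_mono (M := ℚ) (R := ℚ) (s := {A | x ∉ A ∧ insert x A ∈ G})
      (t := {A ∈ G | x ∉ A}) (fun A hA => ⟨hG (Finset.subset_insert x A) hA.2, hA.1⟩) hc
  have hz1 := annihilation_creation_self_add x z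
  have hc1 := boundary_creation_add x c
  rw [hcb] at hc1
  have hac : annihilation x (creation x z) + c = z + boundary (creation x c) := by
    conv_lhs => rw [← hc1]
    rw [add_left_comm, hz1, add_comm]
  obtain ⟨f, hf, hfz⟩ := hdel _ (Submodule.add_mem _ ha hc') (by
    rw [hac, map_add, hz0, boundary_boundary, add_zero])
  refine ⟨f - creation x c, Submodule.sub_mem _
    (Finsupp.supported_mono (fun A hA => hA.1) hf) hwc, ?_⟩
  rw [map_sub, hfz, hac, add_sub_cancel_right]

/-- `X` holds the undecided elements, `Y` those known to be present. A NO answer passes to the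
deletion, a YES answer to the link. At a leaf `X` is still nonempty, so `G` is either void or the
full simplex on `X`, a cone. -/
theorem isAcyclic_of_depth_lt (T : DecisionTree E) :
    ∀ (X Y : Finset E) (G : Set (Finset E)), IsLowerSet G → (∀ A ∈ G, A ⊆ X) → Disjoint X Y →
      (∀ A ⊆ X, T.run (↑(A ∪ Y) : Set E) = true ↔ A ∈ G) → T.depth < X.card → IsAcyclic G := by
  induction T with
  | leaf answer =>
    intro X Y G _ hX _ hT hdepth
    obtain ⟨x, hx⟩ := Finset.card_pos.1 (Nat.zero_lt_of_lt hdepth)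
    cases answer with
    | false =>
      have : G = ∅ := Set.eq_empty_of_forall_notMem fun A hA => by
        simpa [DecisionTree.run] using (hT A (hX A hA)).2 hA
      exact this ▸ isAcyclic_empty
    | true =>
      exact isAcyclic_of_cone x fun A hA =>
        (hT _ (Finset.insert_subset hx (hX A hA))).1 (by simp [DecisionTree.run])
  | node e no yes ihno ihyes =>
    intro X Y G hG hX hXY hT hdepth
    simp only [DecisionTree.depth] at hdepth
    by_cases he : e ∈ X
    · have heY : e ∉ Y := Finset.disjoint_left.1 hXY he
      have hcard := Finset.card_erase_add_one he
      refine isAcyclic_of_deletion_of_link hG e ?_ ?_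
      · refine ihno (X.erase e) Y _ (fun A B hBA hA => ⟨hG hBA hA.1, fun h => hA.2 (hBA h)⟩)
          (fun A hA => Finset.subset_erase.2 ⟨hX A hA.1, hA.2⟩)
          (hXY.mono_left (Finset.erase_subset e X)) (fun A hA => ?_) (by omega)
        have hA' := Finset.subset_erase.1 hA
        have := hT A hA'.1
        rw [DecisionTree.run, if_neg (by simp [hA'.2, heY])] at this
        rw [this]
        exact (and_iff_left hA'.2).symm
      · refine ihyes (X.erase e) (insert e Y) _
          (fun A B hBA hA => ⟨fun h => hA.1 (hBA h), hG (Finset.insert_subset_insert e hBA) hA.2⟩)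
          (fun A hA => Finset.subset_erase.2
            ⟨(Finset.subset_insert e A).trans (hX _ hA.2), hA.1⟩)
          (Finset.disjoint_insert_right.2
            ⟨Finset.notMem_erase e X, hXY.mono_left (Finset.erase_subset e X)⟩)
          (fun A hA => ?_) (by omega)
        have hA' := Finset.subset_erase.1 hA
        have := hT (insert e A) (Finset.insert_subset he hA'.1)
        rw [DecisionTree.run, if_pos (by simp), Finset.insert_union, ← Finset.union_insert] at this
        rw [this]
        exact (and_iff_right hA'.2).symm
    -- The answer to this question is already known, so only the tree shrinks.
    · by_cases heY : e ∈ Y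
      · refine ihyes X Y G hG hX hXY (fun A hA => ?_) (by omega)
        rw [← hT A hA, DecisionTree.run, if_pos (by simp [heY])]
      · refine ihno X Y G hG hX hXY (fun A hA => ?_) (by omega)
        rw [← hT A hA, DecisionTree.run, if_neg]
        simpa [heY] using fun h => he (hA h)

open Classical in
/-- The Hopf trace formula for a symmetry of an acyclic complex. -/
theorem sum_inversionSign_eq_zero {G : Set (Finset E)} (hG : IsLowerSet G) (hac : IsAcyclic G)
    (σ : Equiv.Perm E) (hσ : ∀ A ∈ G, A.map σ.toEmbedding ∈ G) :
    ∑ A : Finset E, (if A ∈ G ∧ A.map σ.toEmbedding = A then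
      (-1) ^ A.card * inversionSign σ A else 0) = 0 := by
  let C := Finsupp.supported ℚ ℚ G
  let L := parity ∘ₗ permAction σ
  have hLs : ∀ A q, L (Finsupp.single A q) = Finsupp.single (A.map σ.toEmbedding)
      (q * ((-1) ^ A.card * inversionSign σ A)) := fun A q => by
    simp only [L, LinearMap.comp_apply, permAction_single, parity_single, Finset.card_map]
    congr 1
    ring
  have hL : ∀ z ∈ C, L z ∈ C := fun z hz => map_mem_supported (fun A hA q => by
    rw [hLs]
    exact Finsupp.single_mem_supported _ _ (hσ A hA)) hz
  have hd : ∀ z ∈ C, boundary z ∈ C := fun z hz => boundary_mem_supported hG hz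
  have htr : LinearMap.trace ℚ C (L.restrict hL) = 0 := by
    refine trace_eq_zero_of_anticommute (d := boundary.restrict hd)
      (fun z => Subtype.ext (boundary_boundary _)) (fun z hz => ?_) (fun z => Subtype.ext ?_)
    · obtain ⟨c, hc, hcz⟩ := hac z z.2 (congrArg Subtype.val hz)
      exact ⟨⟨c, hc⟩, Subtype.ext hcz⟩
    · change boundary (parity (permAction σ z)) = -parity (permAction σ (boundary z))
      rw [boundary_parity, boundary_permAction]
  let b : Module.Basis G ℚ C := Module.Basis.ofRepr (Finsupp.supportedEquivFinsupp G)
  have hb : ∀ A : G, ((b A : C) : Finset E →₀ ℚ) = Finsupp.single (A : Finset E) 1 := by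
    intro A
    change (((Finsupp.supportedEquivFinsupp G).symm (Finsupp.single A 1) : C) : Finset E →₀ ℚ) = _
    exact Finsupp.supportedEquivFinsupp_symm_single G A (1 : ℚ)
  -- In the basis of faces only those fixed by `σ` have a nonzero diagonal entry.
  rw [LinearMap.trace_eq_matrix_trace ℚ b, Matrix.trace] at htr
  refine Eq.trans ?_ htr
  have hdiag : ∀ A : G, (LinearMap.toMatrix b b (L.restrict hL)).diag A =
      if (A : Finset E).map σ.toEmbedding = A then
        (-1) ^ (A : Finset E).card * inversionSign σ (A : Finset E) else 0 := by
    intro A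
    rw [Matrix.diag_apply, LinearMap.toMatrix_apply]
    change (L (b A : C)) (A : Finset E) = _
    rw [hb, hLs, one_mul, Finsupp.single_apply]
  simp only [ite_and]
  rw [Finset.sum_congr rfl fun A _ => hdiag A, ← Finset.sum_filter (p := (· ∈ G))]
  exact Finset.sum_subtype _ (p := (· ∈ G)) (fun A => by simp)
    (fun A => if A.map σ.toEmbedding = A then (-1) ^ A.card * inversionSign σ A else 0)

end Acyclic

/-! ### Truncated binomial sums and preliminaries on complexity. -/

open Classical in
theorem of_alternating_sum_eq_zero {V : Type*} [Fintype V] {P : Finset V → Prop}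
    (hP : ∀ S S' : Finset V, P S → S'.card ≤ S.card → P S') (h0 : P ∅)
    (hsum : ∑ S : Finset V, (if P S then (-1 : ℚ) ^ S.card else 0) = 0) : P Finset.univ := by
  by_contra huniv
  have hex : ∃ j, ¬ ∃ S : Finset V, P S ∧ S.card = j := ⟨Fintype.card V, fun ⟨S, hS, hc⟩ =>
    huniv (hP S _ hS (by rw [hc, Finset.card_univ]))⟩
  -- `Nat.find hex` is the least size at which `P` fails; written `k + 1`, it turns the sum into
  -- `(-1) ^ k * n.choose k` with `|V| = n + 1` and `k ≤ n`.
  have hspec := Nat.find_spec hex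
  have hmin := fun j => Nat.find_min (H := hex) (m := j)
  have hle : Nat.find hex ≤ Fintype.card V := Nat.find_min' hex fun ⟨S, hS, hc⟩ =>
    huniv (hP S _ hS (by rw [hc, Finset.card_univ]))
  have hne : Nat.find hex ≠ 0 := fun h => hspec ⟨∅, h0, by rw [h, Finset.card_empty]⟩
  obtain ⟨k, hk⟩ := Nat.exists_eq_succ_of_ne_zero hne
  rw [hk] at hspec hmin hle
  obtain ⟨n, hn⟩ : ∃ n, Fintype.card V = n + 1 := ⟨Fintype.card V - 1, by omega⟩
  have hPk : ∀ S, P S ↔ S.card < k + 1 := by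
    refine fun S => ⟨fun hS => ?_, fun hS => ?_⟩
    · by_contra hlt
      obtain ⟨S', -, hS'⟩ := Finset.exists_subset_card_eq (not_lt.1 hlt)
      exact hspec ⟨S', hP S S' hS (by omega), hS'⟩
    · obtain ⟨S', hS', hc⟩ := not_not.1 (hmin _ hS)
      exact hP S' S hS' hc.ge
  have hcount := Finset.sum_powerset_apply_card (fun j => if j < k + 1 then (-1 : ℚ) ^ j else 0)
    (x := (Finset.univ : Finset V))
  rw [Finset.powerset_univ] at hcount
  simp only [hPk] at hsum
  rw [hsum, Finset.card_univ, hn] at hcount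
  simp only [smul_ite, smul_zero] at hcount
  rw [← Finset.sum_filter] at hcount
  have hfilter : (Finset.range (n + 1 + 1)).filter (· < k + 1) = Finset.range (k + 1) := by
    ext j
    simp only [Finset.mem_filter, Finset.mem_range]
    omega
  have hchoose := Int.alternating_sum_range_choose_eq_choose (n := n) (m := k)
  have hchoose' := congrArg (Int.cast : ℤ → ℚ) hchoose
  push_cast at hchoose'
  rw [hfilter] at hcount
  simp only [nsmul_eq_mul, mul_comm ((Nat.choose _ _ : ℕ) : ℚ)] at hcount
  rw [hchoose'] at hcount
  have hpos : n.choose k ≠ 0 := (Nat.choose_pos (by omega)).ne'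
  exact mul_ne_zero (pow_ne_zero k (by norm_num)) (Nat.cast_ne_zero.2 hpos) hcount.symm

theorem exists_perm_map_eq {V : Type*} [Finite V] {S S' : Finset V} (h : S.card = S'.card) :
    ∃ σ : Equiv.Perm V, σ '' (S : Set V) = S' := by
  classical
  have := Fintype.ofFinite V
  let e : {x // x ∈ S} ≃ {x // x ∈ S'} := Finset.equivOfCardEq h
  refine ⟨e.extendSubtype, Set.eq_of_subset_of_ncard_le ?_ ?_⟩
  · rintro _ ⟨x, hx, rfl⟩
    exact e.extendSubtype_mem x hx
  · rw [Set.ncard_image_of_injective _ e.extendSubtype.injective, Set.ncard_coe_finset,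
      Set.ncard_coe_finset, h]

theorem argumentComplexity_le {E : Type*} {F : Set (Set E)} {T : DecisionTree E}
    (hT : T.Decides F) : argumentComplexity F ≤ T.depth :=
  Nat.sInf_le ⟨T, hT, rfl⟩

theorem isTrivial_empty {E : Type*} : IsTrivial (∅ : Set (Set E)) :=
  Nat.le_zero.1 <| argumentComplexity_le (T := .leaf false) fun A => by simp [DecisionTree.run]

theorem isTrivial_univ {E : Type*} : IsTrivial (Set.univ : Set (Set E)) :=
  Nat.le_zero.1 <| argumentComplexity_le (T := .leaf true) fun A => by simp [DecisionTree.run]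

theorem isAcyclic_of_not_isEvasive {E : Type*} [LinearOrder E] [Fintype E] {F : Set (Set E)}
    (hmono : IsMonotone F) (hF : ¬ IsEvasive F) :
    IsAcyclic {A : Finset E | (A : Set E) ∈ F} := by
  obtain ⟨T₀, hT₀, hd₀⟩ := exists_decides F
  obtain ⟨T, hT, hd⟩ : ∃ T : DecisionTree E, T.Decides F ∧ T.depth = argumentComplexity F :=
    Nat.sInf_mem (s := {d : ℕ | ∃ T : DecisionTree E, T.Decides F ∧ T.depth = d})
      ⟨_, T₀, hT₀, rfl⟩
  have hlt : T.depth < Nat.card E :=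
    hd ▸ lt_of_le_of_ne ((argumentComplexity_le hT₀).trans hd₀) hF
  refine isAcyclic_of_depth_lt T Finset.univ ∅ _
    (fun A B hBA hA => hmono A B hA (Finset.coe_subset.2 hBA)) (fun A _ => Finset.subset_univ A)
    (Finset.disjoint_empty_right _) (fun A _ => ?_) ?_
  · rw [Finset.union_empty]; exact hT A
  · rwa [Finset.card_univ, ← Nat.card_eq_fintype_card]

/-! ### The cyclic rotation of `W`: invariant sets and signs. -/

section Rotation

variable {V W : Type*} {k : ℕ} {g : W ≃ Fin (k + 1)} {τ : Equiv.Perm W}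

/-- Since `τ` is a single cycle on `W`, each row `{v} × W` lies in `A` entirely or not at all. -/
theorem exists_eq_product_univ_of_map_eq [Fintype W] (hτ : ∀ w, g (τ w) = g w + 1)
    {A : Finset (V × W)}
    (hA : A.map (Equiv.prodCongr (Equiv.refl V) τ).toEmbedding = A) :
    ∃ S : Finset V, S ×ˢ (Finset.univ : Finset W) = A := by
  classical
  have step : ∀ v w, (v, τ w) ∈ A ↔ (v, w) ∈ A := fun v w => by
    conv_lhs => rw [← hA]
    exact Finset.mem_map' (Equiv.prodCongr (Equiv.refl V) τ).toEmbedding (a := (v, w))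
  have hsucc : ∀ i : Fin k, g.symm i.succ = τ (g.symm i.castSucc) := fun i => by
    rw [Equiv.symm_apply_eq, hτ, Equiv.apply_symm_apply, Fin.coeSucc_eq_succ]
  have key : ∀ v i, (v, g.symm i) ∈ A ↔ (v, g.symm 0) ∈ A := fun v i => by
    induction i using Fin.induction with
    | zero => rfl
    | succ i ih => rw [hsucc, step, ih]
  have key' : ∀ v w, (v, w) ∈ A ↔ (v, g.symm 0) ∈ A := fun v w => by
    simpa using key v (g w)
  refine ⟨A.image Prod.fst, ?_⟩
  ext ⟨v, w⟩
  simp only [Finset.mem_product, Finset.mem_image, Finset.mem_univ, and_true]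
  constructor
  · rintro ⟨⟨v', w'⟩, h, rfl⟩
    exact (key' _ _).2 ((key' _ _).1 h)
  · exact fun h => ⟨_, h, rfl⟩

theorem map_product_univ [Fintype W] (τ : Equiv.Perm W) (S : Finset V) :
    (S ×ˢ (Finset.univ : Finset W)).map (Equiv.prodCongr (Equiv.refl V) τ).toEmbedding =
      S ×ˢ Finset.univ := by
  refine Finset.eq_of_subset_of_card_le ?_ (by rw [Finset.card_map])
  intro p hp
  obtain ⟨⟨v, w⟩, h, rfl⟩ := Finset.mem_map.1 hp
  simpa using h

/-- Only the last element wraps around, to `0`, and it is inverted with each of the `k` others. -/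
theorem prod_inversions_add_one (k : ℕ) :
    ∏ i : Fin (k + 1), ∏ j : Fin (k + 1), (if j < i ∧ i + 1 < j + 1 then (-1 : ℚ) else 1) =
      (-1) ^ k := by
  rw [Fin.prod_univ_castSucc]
  have h1 : ∀ i : Fin k, ∏ j : Fin (k + 1),
      (if j < i.castSucc ∧ i.castSucc + 1 < j + 1 then (-1 : ℚ) else 1) = 1 := fun i =>
    Finset.prod_eq_one fun j _ => if_neg fun ⟨hji, hij⟩ => by
      have hj : j < Fin.last k := hji.trans (Fin.castSucc_lt_last i)
      rw [Fin.lt_def, Fin.val_add_one_of_lt (Fin.castSucc_lt_last i),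
        Fin.val_add_one_of_lt hj] at hij
      rw [Fin.lt_def] at hji
      omega
  have h2 : ∀ j : Fin k, (j.castSucc < Fin.last k ∧ Fin.last k + 1 < j.castSucc + 1) := fun j =>
    ⟨Fin.castSucc_lt_last j, by
      rw [Fin.last_add_one, Fin.coeSucc_eq_succ]
      exact Fin.succ_pos j⟩
  rw [Finset.prod_eq_one fun i _ => h1 i, one_mul, Fin.prod_univ_castSucc]
  simp only [h2, and_self, if_true, lt_irrefl, if_false, Finset.prod_const, Finset.card_univ,
    Fintype.card_fin, mul_one]

/-- The order hypotheses abstract the lexicographic order: pairs in different rows are never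
inverted, and each row contributes `k` inversions. -/
theorem inversionSign_product_univ [Fintype W] [LinearOrder (V × W)]
    (hτ : ∀ w, g (τ w) = g w + 1)
    (hfst : ∀ (v v' : V) (w w' : W), v ≠ v' → (v, w) < (v', w') → (v, τ w) < (v', τ w'))
    (hsnd : ∀ (v : V) (w w' : W), (v, w) < (v, w') ↔ g w < g w') (S : Finset V) :
    inversionSign (Equiv.prodCongr (Equiv.refl V) τ) (S ×ˢ Finset.univ) =
      ((-1) ^ k) ^ S.card := by
  rw [inversionSign, Finset.prod_product, ← Finset.prod_const]
  refine Finset.prod_congr rfl fun v hv => ?_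
  rw [← prod_inversions_add_one, ← Equiv.prod_comp g]
  refine Finset.prod_congr rfl fun w _ => ?_
  rw [Finset.prod_product, Finset.prod_eq_single v, ← Equiv.prod_comp g]
  · simp only [Equiv.prodCongr_apply, Prod.map_apply, Equiv.refl_apply, hsnd, hτ]
  · refine fun v' _ hv' => Finset.prod_eq_one fun w' _ => if_neg fun ⟨h1, h2⟩ => ?_
    exact lt_asymm (hfst v' v w' w hv' h1) h2
  · exact fun h => absurd hv h

end Rotation

/-! ### Application to bipartite graph properties. -/

section BipartiteGraph

variable {V W : Type*} [Fintype V] {F : Set (Set (V × W))}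

theorem IsBipartiteGraphProperty.prod_univ_mem (hF : IsBipartiteGraphProperty F)
    (hmono : IsMonotone F) {S S' : Finset V} (hS : (S : Set V) ×ˢ (Set.univ : Set W) ∈ F)
    (hcard : S'.card ≤ S.card) : (S' : Set V) ×ˢ (Set.univ : Set W) ∈ F := by
  obtain ⟨S₀, hS₀, hc⟩ := Finset.exists_subset_card_eq hcard
  obtain ⟨σ, hσ⟩ := exists_perm_map_eq hc
  have h := hF σ (Equiv.refl W) _
    (hmono _ _ hS (Set.prod_mono_left (t := Set.univ) (Finset.coe_subset.2 hS₀)))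
  rwa [Set.prodMap_image_prod, hσ, Equiv.coe_refl, Set.image_id] at h

open Classical in
theorem alternating_sum_eq_zero_of_not_isEvasive [Fintype W] {k : ℕ} (g : W ≃ Fin (k + 1))
    (hF : IsBipartiteGraphProperty F) (hmono : IsMonotone F) (hev : ¬ IsEvasive F) :
    ∑ S : Finset V, (if (S : Set V) ×ˢ (Set.univ : Set W) ∈ F then (-1 : ℚ) ^ S.card else 0) =
      0 := by
  let f := Fintype.equivFin V
  let τ : Equiv.Perm W := (g.trans (Equiv.addRight 1)).trans g.symm
  have hτ : ∀ w, g (τ w) = g w + 1 := fun w => g.apply_symm_apply _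
  let φ : V × W → Fin (Fintype.card V) ×ₗ Fin (k + 1) := fun p => toLex (f p.1, g p.2)
  let _ : LinearOrder (V × W) := LinearOrder.lift' φ fun p q h => by
    have h' := Prod.ext_iff.1 (toLex.injective h)
    exact Prod.ext (f.injective h'.1) (g.injective h'.2)
  have hlt : ∀ p q : V × W, p < q ↔ f p.1 < f q.1 ∨ f p.1 = f q.1 ∧ g p.2 < g q.2 :=
    fun p q => Prod.Lex.toLex_lt_toLex
  let σ := Equiv.prodCongr (Equiv.refl V) τ
  have hsign : ∀ S : Finset V, inversionSign σ (S ×ˢ Finset.univ) = ((-1) ^ k) ^ S.card := by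
    refine inversionSign_product_univ hτ (fun v v' w w' hv h => ?_) (fun v w w' => ?_)
    · rw [hlt] at h ⊢
      exact Or.inl (h.resolve_right fun h => hv (f.injective h.1))
    · rw [hlt]
      simp
  have hW : Fintype.card W = k + 1 := by simpa using Fintype.card_congr g
  have hsum := sum_inversionSign_eq_zero
    (fun A B hBA hA => hmono A B hA (Finset.coe_subset.2 hBA))
    (isAcyclic_of_not_isEvasive hmono hev) σ (fun A hA => by
      change ((A.map σ.toEmbedding : Finset (V × W)) : Set (V × W)) ∈ F
      rw [Finset.coe_map]
      exact hF (Equiv.refl V) τ A hA)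
  refine Eq.trans ?_ hsum
  refine Finset.sum_of_injOn (fun S => S ×ˢ Finset.univ) ?_ (fun _ _ => Finset.mem_univ _) ?_ ?_
  · intro S _ S' _ h
    have hne : Nonempty W := ⟨g.symm 0⟩
    have := congrArg (Finset.image Prod.fst) h
    simpa [Finset.product_image_fst, Finset.univ_nonempty] using this
  · intro A _ hA
    refine if_neg fun h => hA ?_
    obtain ⟨S, hS⟩ := exists_eq_product_univ_of_map_eq hτ h.2
    exact ⟨S, by simp, hS⟩
  · intro S _
    have hmem : ((S ×ˢ Finset.univ : Finset (V × W)) : Set (V × W)) =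
        (S : Set V) ×ˢ (Set.univ : Set W) := by
      rw [Finset.coe_product, Finset.coe_univ]
    simp only [Set.mem_ofPred_eq, hmem, hsign, σ, map_product_univ τ S, and_true]
    congr 1
    -- The exponents `|S| (k + 1)` and `k |S|` add up to `|S| (2 k + 1)`, which has the parity of
    -- `|S|`.
    rw [Finset.card_product, Finset.card_univ, hW, mul_comm S.card, pow_mul, ← mul_pow, pow_succ,
      mul_right_comm, ← mul_pow]
    norm_num

end BipartiteGraph

end Evasiveness

theorem mainTheorem3 {V W : Type*} [Finite V] [Finite W] (F : Set (Set (V × W)))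
    (hF : Evasiveness.IsBipartiteGraphProperty F) (hmono : Evasiveness.IsMonotone F)
    (hnontriv : ¬ Evasiveness.IsTrivial F) : Evasiveness.IsEvasive F := by
  have := Fintype.ofFinite V
  have := Fintype.ofFinite W
  by_contra hev
  -- If `W` is empty, there are no potential edges, and every property is evasive with complexity
  -- `0`.
  obtain ⟨k, hk⟩ : ∃ k, Fintype.card W = k + 1 := by
    refine Nat.exists_eq_succ_of_ne_zero fun h0 => hev ?_
    obtain ⟨T, hT, hd⟩ := Evasiveness.exists_decides F
    have hE : Nat.card (V × W) = 0 := by simp [h0]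
    have hle := (Evasiveness.argumentComplexity_le hT).trans hd
    exact (Nat.le_zero.1 (hE ▸ hle)).trans hE.symm
  have hempty : ∅ ∈ F := by
    by_contra h
    refine hnontriv ?_
    rw [Set.eq_empty_of_forall_notMem fun A hA => h (hmono A ∅ hA (Set.empty_subset A))]
    exact Evasiveness.isTrivial_empty
  have huniv := Evasiveness.of_alternating_sum_eq_zero
    (P := fun S : Finset V => (S : Set V) ×ˢ (Set.univ : Set W) ∈ F)
    (fun S S' hS hcard => hF.prod_univ_mem hmono hS hcard) (by simpa using hempty)
    (by convert Evasiveness.alternating_sum_eq_zero_of_not_isEvasive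
          (Fintype.equivFinOfCardEq hk) hF hmono hev)
  rw [Finset.coe_univ, Set.univ_prod_univ] at huniv
  refine hnontriv ?_
  rw [Set.eq_univ_of_forall fun A => hmono _ A huniv (Set.subset_univ A)]
  exact Evasiveness.isTrivial_univ
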